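/- Words are finite sequences $w=w_1\cdots w_m$ of positive integers, with length $|w|=m$, norm $\|w\|=w_1+\cdots+w_m$ and reversal $\tilde w=w_m\cdots w_1$. For words $u,w$ let $Em(u,w)$ be the set of all $j\ge 1$ such that $j+|u|-1\le |w|$ and $u_i\le w_{j+i-1}$ for all $1\le i\le |u|$. Words $u,v$ are super-strongly Wilf equivalent, $u\sim_{ss}v$, if there is a bijection $f$ of the set of all words onto itself with $|f(w)|=|w|$, $\|f(w)\|=\|w\|$ and $Em(u,w)=Em(v,f(w))$ for every word $w$. The skyline diagram of $u$ consists of adjoining columns of squares, the $i$-th column having $u_i$ squares. A rigid shift of $u$ is a word $v$ of the same length obtained by cutting this diagram at some height $h$ and rigidly moving all blocks above the cut together horizontally so that each moved column comes to rest on a column of height $h$. Two words are shift equivalent if one is obtained from the other by a finite sequence of rigid shifts and reversals. Let $n\ge 1$ and let $\mathcal S_n$ be the set of words in which each of $1,\dots,n$ occurs exactly once and no other letter occurs. For $u\in\mathcal S_n$ let $[u]_{sh}$ and $[u]_{ss}$ be the sets of the words in $\mathcal S_n$ that are shift equivalent, respectively super-strongly Wilf equivalent, to $u$. Let $id=1\,2\cdots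 n$ and, when $n\ge 3$, let $v=1\,2\cdots(n-3)\,(n-1)\,(n-2)\,n$. Then for every $u\in\mathcal S_n$ $$[u]_{sh}=\begin{cases}[u]_{ss}, & \text{if } u\sim_{ss} id, \text{ or } n\ge 3 \text{ and } u\sim_{ss} v,\\ [u]_{ss}\sqcup[\tilde u]_{ss}, & \text{otherwise,}\end{cases}$$ where $\sqcup$ denotes a union of disjoint sets. -/

import Mathlib

/-- Words on the alphabet of positive integers. -/
abbrev PWord : Type := List ℕ+

/-- The height (norm) of a word: the sum of its letters. -/
def PWord.norm (w : PWord) : ℕ := (w.map (fun a : ℕ+ => (a : ℕ))).sum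

/-- `PWord.Em u w` is the set of embedding indices (counted from `1`) of `u` into `w` for the
generalized factor order: the positions at which a factor of `w` begins that has the same length
as `u` and dominates `u` letter by letter. -/
def PWord.Em (u w : PWord) : Set ℕ :=
  {j | ∃ s v t : PWord, w = s ++ v ++ t ∧ List.Forall₂ (· ≤ ·) u v ∧ j = s.length + 1}

/-- Super-strong Wilf equivalence of words: there is a bijection of the set of all words that
preserves the weight (the length and the norm) and carries embedding sets of `u` to embedding
sets of `v`. -/
def SuperStrongWilfEquiv (u v : PWord) : Prop :=
  ∃ f : PWord ≃ PWord,
    (∀ w : PWord, (f w).length = w.length ∧ (f w).norm = w.norm) ∧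
    ∀ w : PWord, PWord.Em u w = PWord.Em v (f w)

/-- The height of the column of the skyline diagram of `w` at the integer abscissa `i`; the
columns of `w` stand at `0, …, w.length - 1`, and the height is `0` elsewhere. -/
def PWord.col (w : PWord) (i : ℤ) : ℕ :=
  if i < 0 then 0 else (w.map (fun a : ℕ+ => (a : ℕ))).getD i.toNat 0

/-- `v` is a rigid shift of `u`: the skyline diagram of `u` is cut at height `h` and everything
above the cut is moved by `k` places, each moved (nonempty) column coming to rest on a column
which has height exactly `h` after the cut. The part of column `i` above the cut has height
`u.col i - h` (truncated subtraction), the part below it has height `min (u.col i) h`. -/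
def RigidShift (u v : PWord) : Prop :=
  v.length = u.length ∧
  ∃ (h : ℕ) (k : ℤ),
    (∀ i : ℤ, h < u.col i → min (u.col (i + k)) h = h) ∧
    ∀ j : ℤ, v.col j = min (u.col j) h + (u.col (j - k) - h)

/-- Shift equivalence: `v` is obtained from `u` by a finite sequence of rigid shifts and
reversals. (Both kinds of moves can be undone by moves of the same kind.) -/
def ShiftEquiv (u v : PWord) : Prop :=
  Relation.ReflTransGen (fun a b : PWord => RigidShift a b ∨ b = a.reverse) u v

/-- The set `𝒮ₙ` of permutations of `1, …, n`, written as words. -/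
def permWords (n : ℕ) : Set PWord :=
  {w | w.Nodup ∧ ∀ a : ℕ+, a ∈ w ↔ (a : ℕ) ≤ n}

/-- The super-strong Wilf equivalence class of `u` in `𝒮ₙ`. -/
def ssClass (n : ℕ) (u : PWord) : Set PWord :=
  {w | w ∈ permWords n ∧ SuperStrongWilfEquiv u w}

/-- The shift equivalence class of `u` in `𝒮ₙ`. -/
def shClass (n : ℕ) (u : PWord) : Set PWord :=
  {w | w ∈ permWords n ∧ ShiftEquiv u w}

/-- The identity permutation `1 2 ⋯ n`. (`Nat.succPNat i` is the letter `i + 1`.) -/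
def idWord (n : ℕ) : PWord := (List.range n).map Nat.succPNat

/-- The permutation `1 2 ⋯ (n-3) (n-1) (n-2) n`, which makes sense for `3 ≤ n`. -/
def swapWord (n : ℕ) : PWord :=
  (List.range (n - 3)).map Nat.succPNat ++
    [Nat.succPNat (n - 2), Nat.succPNat (n - 3), Nat.succPNat (n - 1)]

open Finset

/-! ### Words as skyline functions on the integers, and embeddings as pointwise inequalities. -/

namespace PWord

/-! Everything is reduced to the level sets of a skyline (the columns of height at least `h`) up to
translation, one translation per level: this is `LevelTranslate`.

Rigid shifts preserve these translation classes, and conversely the levels can be put in place one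
at a time from below, so shift equivalence is `LevelTranslate` up to one reversal
(`shiftEquiv_iff`).

On permutations, super-strong equivalence is `LevelTranslate` itself (`superStrongWilfEquiv_iff`).
In one direction, the least word dominating copies of `u` at the places `T` has level sizes, hence a
norm, unchanged by translating levels. This fixes the number of words embedding `u` at least at `T`,
and inclusion-exclusion gives the number embedding it exactly at `T`. In the other direction, the
norms of these least words are invariants, and well chosen `T` recover the levels from the smallest
to the largest.

Hence the shift class is the union of the classes of `u` and its reversal. These coincide or are
disjoint, and coincide exactly when every level of `u` is symmetric. Symmetry forces every level to
be an interval, except possibly the two-element one, which leaves only the identity and `swapWord`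
(`levelTranslate_idWord_or_swapWord`). -/

lemma col_natCast (w : PWord) (i : ℕ) :
    w.col i = (w.map (fun a : ℕ+ => (a : ℕ))).getD i 0 := by
  simp [col]

lemma col_of_lt (w : PWord) (i : ℕ) (hi : i < w.length) : w.col i = (w[i] : ℕ) := by
  rw [col_natCast, List.getD_eq_getElem _ _ (by simpa using hi)]
  simp

lemma col_pos_iff (w : PWord) (x : ℤ) : 0 < w.col x ↔ 0 ≤ x ∧ x < w.length := by
  by_cases hx : x < 0
  · simp [col, hx]
  · lift x to ℕ using not_lt.mp hx
    by_cases h : x < w.length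
    · rw [col_of_lt w x h]
      simp [h]
    · rw [col_natCast, List.getD_eq_default _ _ (by simpa using h)]
      simp
      omega

lemma col_eq_zero (w : PWord) (x : ℤ) (h : ¬(0 ≤ x ∧ x < w.length)) : w.col x = 0 := by
  rw [← col_pos_iff] at h; omega

lemma exists_col_eq (g : ℤ → ℕ) (m : ℕ) (hg : ∀ x, 0 < g x ↔ 0 ≤ x ∧ x < m) :
    ∃ w : PWord, w.length = m ∧ ∀ x, w.col x = g x := by
  refine ⟨List.ofFn (fun i : Fin m => Nat.toPNat (g (i : ℕ)) ((hg _).2 (by have := i.2; omega))),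
    by simp, ?_⟩
  intro x
  by_cases hx : 0 ≤ x ∧ x < m
  · obtain ⟨h0, h1⟩ := hx
    lift x to ℕ using h0
    rw [col_of_lt _ _ (by simpa using h1)]
    simp only [List.getElem_ofFn]
    rfl
  · rw [col_eq_zero _ _ (by simpa using hx)]
    have := (hg x).not.2 hx
    omega

lemma length_eq_of_col_eq {w w' : PWord} (h : ∀ x, w.col x = w'.col x) :
    w.length = w'.length := by
  have h1 := fun x => col_pos_iff w x
  have h2 := fun x => col_pos_iff w' x
  have a := h1 w'.length
  have b := h2 w'.length
  have c := h1 w.length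
  have d := h2 w.length
  rw [h] at a c
  omega

lemma col_injective {w w' : PWord} (h : ∀ x, w.col x = w'.col x) : w = w' := by
  refine List.ext_getElem (length_eq_of_col_eq h) fun i h1 h2 => ?_
  have := h i
  rw [col_of_lt _ _ h1, col_of_lt _ _ h2] at this
  exact PNat.coe_injective this

lemma norm_eq_sum_col (w : PWord) : w.norm = ∑ x ∈ Ico (0 : ℤ) w.length, w.col x := by
  have h : Ico (0 : ℤ) w.length = (range w.length).map Nat.castEmbedding := by
    ext x
    simp only [mem_Ico, mem_map, mem_range, Nat.castEmbedding_apply]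
    constructor
    · rintro ⟨h0, h1⟩
      exact ⟨x.toNat, by omega, by omega⟩
    · rintro ⟨a, h, rfl⟩
      omega
  rw [h, sum_map, norm, Finset.sum_range, ← List.sum_ofFn]
  congr 1
  refine List.ext_getElem (by simp) fun i h1 h2 => ?_
  have h3 : i < w.length := by simpa using h1
  simp [col_of_lt w i h3]

lemma col_reverse (w : PWord) (x : ℤ) : PWord.col w.reverse x = w.col (w.length - 1 - x) := by
  by_cases hx : 0 ≤ x ∧ x < w.length
  · obtain ⟨h0, h1⟩ := hx
    lift x to ℕ using h0
    have h2 : (w.length - 1 - x : ℤ) = ((w.length - 1 - x : ℕ) : ℤ) := by omega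
    rw [h2, col_of_lt _ _ (by simp; omega), col_of_lt _ _ (by omega)]
    simp
  · rw [col_eq_zero _ _ (by simpa using hx), col_eq_zero _ _ (by omega)]

/-- Columns vanish outside a word, so the inequality at the last column of `u` already forces the
copy to fit inside `w`. The empty word has no such column. -/
lemma mem_Em_iff {u : PWord} (hu : u ≠ []) (w : PWord) (j : ℕ) :
    j ∈ Em u w ↔ ∃ i : ℕ, j = i + 1 ∧ ∀ x : ℤ, u.col (x - i) ≤ w.col x := by
  have hlen : 0 < u.length := List.length_pos_iff.2 hu
  constructor
  · rintro ⟨s, v, t, rfl, hf, rfl⟩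
    refine ⟨s.length, rfl, fun x => ?_⟩
    have hl := hf.length_eq
    by_cases hx : 0 ≤ x - s.length ∧ x - s.length < u.length
    · obtain ⟨i, hi⟩ := Int.eq_ofNat_of_zero_le hx.1
      obtain rfl : x = ((s.length + i : ℕ) : ℤ) := by omega
      have hi' : i < u.length := by omega
      rw [hi, col_of_lt _ _ hi', col_of_lt _ _ (by simp; omega)]
      have := (List.forall₂_iff_get.1 hf).2 i hi' (by omega)
      simp only [List.get_eq_getElem] at this
      rw [List.getElem_append_left (by simp; omega), List.getElem_append_right (by omega)]
      simpa using this
    · rw [col_eq_zero _ _ hx]; exact Nat.zero_le _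
  · rintro ⟨i, rfl, h⟩
    have hb : i + u.length ≤ w.length := by
      have h1 := h (i + u.length - 1)
      have h2 := (col_pos_iff u (i + u.length - 1 - i)).2 (by omega)
      have h3 := (col_pos_iff w (i + u.length - 1)).1 (by omega)
      omega
    refine ⟨w.take i, (w.drop i).take u.length, (w.drop i).drop u.length, ?_, ?_, ?_⟩
    · rw [List.append_assoc, List.take_append_drop, List.take_append_drop]
    · refine List.forall₂_iff_get.2 ⟨by simp; omega, fun k h1 h2 => ?_⟩
      have := h ((i + k : ℕ))
      rw [col_of_lt w _ (by omega), show ((i + k : ℕ) : ℤ) - i = (k : ℕ) by push_cast; ring,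
        col_of_lt u _ h1] at this
      simpa using this
    · simp; omega

/-! ### Least dominating words. -/

/-- The height of the least word of length `m` dominating the copies of `u` at the places in
`T`. -/
def env (u : PWord) (T : Finset ℕ) (m : ℕ) (x : ℤ) : ℕ :=
  max (if 0 ≤ x ∧ x < m then 1 else 0) (T.sup fun i => u.col (x - i))

lemma le_env_iff (u : PWord) (T : Finset ℕ) (m : ℕ) (x : ℤ) {h : ℕ} (hh : 2 ≤ h) :
    h ≤ env u T m x ↔ ∃ i ∈ T, h ≤ u.col (x - i) := by
  rw [env, le_max_iff, Finset.le_sup_iff (by simp; omega)]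
  constructor
  · rintro (h1 | h1)
    · split_ifs at h1 <;> omega
    · exact h1
  · exact Or.inr

lemma env_pos_iff {u : PWord} {T : Finset ℕ} {m : ℕ} (hT : ∀ i ∈ T, i + u.length ≤ m) (x : ℤ) :
    0 < env u T m x ↔ 0 ≤ x ∧ x < m := by
  by_cases hx : 0 ≤ x ∧ x < m
  · simp [env, hx]
  · simp only [hx, iff_false, env, if_false]
    rw [not_lt, Nat.max_le]
    refine ⟨by simp, Finset.sup_le fun i hi => ?_⟩
    rw [col_eq_zero]
    have := hT i hi
    omega

lemma env_le_col_iff (u : PWord) (T : Finset ℕ) (w : PWord) :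
    (∀ x, env u T w.length x ≤ w.col x) ↔ ∀ i ∈ T, ∀ x : ℤ, u.col (x - i) ≤ w.col x := by
  have hw := col_pos_iff w
  simp only [env, Nat.max_le, Finset.sup_le_iff]
  refine ⟨fun h i hi x => (h x).2 i hi, fun h x => ⟨?_, fun i hi => h i hi x⟩⟩
  split_ifs with h1
  · exact (hw x).2 h1
  · simp

lemma exists_env_word {u : PWord} {T : Finset ℕ} {m : ℕ} (hT : ∀ i ∈ T, i + u.length ≤ m) :
    ∃ w : PWord, w.length = m ∧ ∀ x, w.col x = env u T m x :=
  exists_col_eq _ m (env_pos_iff hT)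

/-! ### Translation of level sets. -/

/-- All level sets of the skyline of `v` are translates of those of `u`. -/
def LevelTranslate (u v : PWord) : Prop :=
  ∀ h : ℕ, 1 ≤ h → ∃ t : ℤ, ∀ x : ℤ, h ≤ v.col (x + t) ↔ h ≤ u.col x

lemma LevelTranslate.refl (u : PWord) : LevelTranslate u u := fun _ _ => ⟨0, by simp⟩

lemma LevelTranslate.symm {u v : PWord} (h : LevelTranslate u v) : LevelTranslate v u := by
  intro k hk
  obtain ⟨t, ht⟩ := h k hk
  exact ⟨-t, fun x => by rw [← ht, neg_add_cancel_right]⟩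

lemma LevelTranslate.trans {u v w : PWord} (h : LevelTranslate u v) (h' : LevelTranslate v w) :
    LevelTranslate u w := by
  intro k hk
  obtain ⟨t, ht⟩ := h k hk
  obtain ⟨s, hs⟩ := h' k hk
  exact ⟨t + s, fun x => by rw [← add_assoc, hs, ht]⟩

lemma LevelTranslate.length_eq {u v : PWord} (h : LevelTranslate u v) : u.length = v.length := by
  obtain ⟨t, ht⟩ := h 1 le_rfl
  simp only [Nat.succ_le_iff, col_pos_iff] at ht
  have e1 := ht 0
  have e2 := ht (u.length - 1)
  have e3 := ht (-1)
  have e4 := ht u.length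
  have e5 := ht (-t)
  have e6 := ht (v.length - 1 - t)
  omega

lemma LevelTranslate.reverse {u v : PWord} (h : LevelTranslate u v) :
    LevelTranslate u.reverse v.reverse := by
  intro k hk
  obtain ⟨t, ht⟩ := h k hk
  refine ⟨-t, fun x => ?_⟩
  rw [col_reverse, col_reverse, ← ht, h.length_eq]
  ring_nf

/-- Levels up to the cut stay put, since moved blocks land on columns reaching the cut; all levels
above it move by the same `k`. -/
lemma LevelTranslate.of_rigidShift {u v : PWord} (h : RigidShift u v) : LevelTranslate u v := by
  obtain ⟨-, c, k, h1, h2⟩ := h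
  intro j hj
  by_cases hjc : j ≤ c
  · refine ⟨0, fun x => ?_⟩
    have a := h1 (x - k)
    rw [add_zero, h2]
    rw [sub_add_cancel] at a
    omega
  · refine ⟨k, fun x => ?_⟩
    have a := h1 x
    rw [h2, add_sub_cancel_right]
    omega

end PWord

/-! ### Translated level sets imply super-strong equivalence. -/

lemma SuperStrongWilfEquiv.symm {u v : PWord} (h : SuperStrongWilfEquiv u v) :
    SuperStrongWilfEquiv v u := by
  obtain ⟨f, h1, h2⟩ := h
  refine ⟨f.symm, fun w => ?_, fun w => ?_⟩
  · have := h1 (f.symm w)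
    simp only [Equiv.apply_symm_apply] at this
    exact ⟨this.1.symm, this.2.symm⟩
  · rw [h2, Equiv.apply_symm_apply]

/-- Möbius inversion on the subsets of `U`, done as downward induction: subtract from the superset
count the exact counts of all strictly larger sets. -/
lemma card_eq_of_card_superset_eq {α : Type*} (s : Finset α) (e e' : α → Finset ℕ)
    (U : Finset ℕ) (he : ∀ a ∈ s, e a ⊆ U) (he' : ∀ a ∈ s, e' a ⊆ U)
    (h : ∀ T, #{a ∈ s | T ⊆ e a} = #{a ∈ s | T ⊆ e' a}) (T : Finset ℕ) :
    #{a ∈ s | e a = T} = #{a ∈ s | e' a = T} := by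
  classical
  have key : ∀ (e : α → Finset ℕ), (∀ a ∈ s, e a ⊆ U) → ∀ T : Finset ℕ,
      #{a ∈ s | T ⊆ e a} = #{a ∈ s | e a = T} +
        ∑ T' ∈ U.powerset.filter (fun T' => T ⊂ T'), #{a ∈ s | e a = T'} := by
    intro e he T
    have h1 : #{a ∈ s | T ⊆ e a} = #{a ∈ s | e a = T} + #{a ∈ s | T ⊂ e a} := by
      rw [← card_union_of_disjoint, ← filter_or]
      · congr 1
        ext a
        simp only [mem_filter, and_congr_right_iff, subset_iff_ssubset_or_eq]
        intro _
        tauto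
      · rw [disjoint_filter]
        rintro a _ rfl
        exact fun h => h.ne rfl
    have h2 : #{a ∈ s | T ⊂ e a} =
        ∑ T' ∈ U.powerset.filter (fun T' => T ⊂ T'), #{a ∈ s | e a = T'} := by
      rw [card_eq_sum_card_fiberwise (f := e) (t := U.powerset.filter (fun T' => T ⊂ T'))]
      · refine sum_congr rfl fun T' hT' => ?_
        rw [filter_filter]
        congr 1
        ext a
        simp only [mem_filter] at hT' ⊢
        constructor
        · tauto
        · rintro ⟨ha, rfl⟩
          exact ⟨ha, hT'.2, rfl⟩
      · intro a ha
        simp only [mem_coe, mem_filter, mem_powerset] at ha ⊢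
        exact ⟨he a ha.1, ha.2⟩
    rw [h1, h2]
  by_cases hTU : T ⊆ U
  · refine Finset.strongDownwardInductionOn (n := #U) (p := fun T => T ⊆ U →
      #{a ∈ s | e a = T} = #{a ∈ s | e' a = T}) T ?_ (card_le_card hTU) hTU
    intro T ih _ hTU
    have h1 := h T
    rw [key e he, key e' he', sum_congr rfl (g := fun T' => #{a ∈ s | e' a = T'})] at h1
    · omega
    · intro T' hT'
      simp only [mem_filter, mem_powerset] at hT'
      exact ih (card_le_card hT'.1) hT'.2 hT'.1
  · rw [filter_false_of_mem, filter_false_of_mem]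
    · rintro a ha rfl; exact hTU (he' a ha)
    · rintro a ha rfl; exact hTU (he a ha)

namespace PWord

lemma finite_length_norm (m N : ℕ) : {w : PWord | w.length = m ∧ w.norm = N}.Finite := by
  have hle : ∀ w : PWord, w.norm = N → ∀ i : ℕ, w.col i < N + 1 := by
    intro w hw i
    rw [Nat.lt_succ_iff, ← hw, norm_eq_sum_col]
    by_cases hi : i < w.length
    · exact single_le_sum (f := fun x => w.col x) (fun _ _ => Nat.zero_le _) (by simp [hi])
    · rw [col_eq_zero _ _ (by omega)]; exact Nat.zero_le _
  refine Set.Finite.of_injOn (t := (Set.univ : Set (Fin m → Fin (N + 1))))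
    (f := fun w i => Fin.ofNat (N + 1) (w.col (i : ℕ))) (fun _ _ => Set.mem_univ _) ?_
    Set.finite_univ
  rintro w ⟨hw1, hw2⟩ w' ⟨hw1', hw2'⟩ h
  refine col_injective fun x => ?_
  by_cases hx : 0 ≤ x ∧ x < m
  · obtain ⟨h0, h1⟩ := hx
    lift x to ℕ using h0
    have := congrArg Fin.val (congrFun h ⟨x, by omega⟩)
    simpa [Fin.ofNat, Nat.mod_eq_of_lt (hle w hw2 x), Nat.mod_eq_of_lt (hle w' hw2' x)] using this
  · rw [col_eq_zero _ _ (by omega), col_eq_zero _ _ (by omega)]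

/-- The words of length `m` and norm `N`. -/
noncomputable def wordsOf (m N : ℕ) : Finset PWord := (finite_length_norm m N).toFinset

lemma mem_wordsOf {m N : ℕ} {w : PWord} : w ∈ wordsOf m N ↔ w.length = m ∧ w.norm = N := by
  simp [wordsOf]

open Classical in
-- Replacing `w` by `w - g + g'` columnwise is injective on words dominating `g`, and keeps the norm
-- because `g` and `g'` have equal sums.
lemma card_dominating_le {m N : ℕ} {g g' : ℤ → ℕ} (hg' : ∀ x, 0 < g' x ↔ 0 ≤ x ∧ x < m)
    (h : ∑ x ∈ Ico (0 : ℤ) m, g x = ∑ x ∈ Ico (0 : ℤ) m, g' x) :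
    #{w ∈ wordsOf m N | ∀ x, g x ≤ w.col x} ≤ #{w ∈ wordsOf m N | ∀ x, g' x ≤ w.col x} := by
  have ex : ∀ w : PWord, w.length = m → ∃ w' : PWord, w'.length = m ∧
      ∀ x, w'.col x = w.col x - g x + g' x := by
    intro w hw
    refine exists_col_eq _ m fun x => ?_
    have h1 := hg' x
    have h2 := col_pos_iff w x
    rw [hw] at h2
    omega
  choose! F hF1 hF2 using ex
  refine card_le_card_of_injOn F ?_ ?_
  · intro w hw
    simp only [mem_coe, mem_filter, mem_wordsOf] at hw ⊢
    obtain ⟨⟨hm, hN⟩, hle⟩ := hw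
    refine ⟨⟨hF1 w hm, ?_⟩, fun x => by rw [hF2 w hm]; omega⟩
    rw [norm_eq_sum_col, hm] at hN
    rw [norm_eq_sum_col, hF1 w hm, sum_congr rfl fun x _ => hF2 w hm x, sum_add_distrib, ← h,
      ← sum_add_distrib, ← hN]
    exact sum_congr rfl fun x _ => Nat.sub_add_cancel (hle x)
  · intro w hw w' hw' heq
    simp only [mem_coe, mem_filter, mem_wordsOf] at hw hw'
    refine col_injective fun x => ?_
    have h1 := hF2 w hw.1.1 x
    have h2 := hF2 w' hw'.1.1 x
    have h3 := hw.2 x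
    have h4 := hw'.2 x
    rw [heq] at h1
    omega

lemma sum_eq_sum_card_le {ι : Type*} (I : Finset ι) (g : ι → ℕ) (B : ℕ) (hB : ∀ x ∈ I, g x ≤ B) :
    ∑ x ∈ I, g x = ∑ h ∈ Icc 1 B, #{x ∈ I | h ≤ g x} := by
  simp only [card_filter]
  rw [sum_comm]
  refine sum_congr rfl fun x hx => ?_
  rw [← card_filter]
  have : {h ∈ Icc 1 B | h ≤ g x} = Icc 1 (g x) := by
    ext h
    have := hB x hx
    simp only [mem_filter, mem_Icc]
    omega
  rw [this, Nat.card_Icc]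
  omega

lemma exists_col_le (w : PWord) : ∃ B, ∀ x, w.col x ≤ B := by
  refine ⟨w.norm, fun x => ?_⟩
  rw [norm_eq_sum_col]
  by_cases hx : 0 ≤ x ∧ x < w.length
  · exact single_le_sum (f := fun x => w.col x) (fun _ _ => Nat.zero_le _) (by simpa using hx)
  · rw [col_eq_zero _ _ hx]; exact Nat.zero_le _

lemma env_le {u : PWord} {B : ℕ} (hB : ∀ x, u.col x ≤ B) (h1 : 1 ≤ B) (T : Finset ℕ) (m : ℕ)
    (x : ℤ) : env u T m x ≤ B := by
  refine Nat.max_le.2 ⟨?_, Finset.sup_le fun i _ => hB _⟩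
  split_ifs <;> omega

/-- From height 2 on, a level of `env` is the sumset of `T` with a level of the word, so translating
the latter translates the former. Height 1 is the whole window. -/
lemma card_le_env_le {u v : PWord} (h : LevelTranslate u v) {T : Finset ℕ} {m : ℕ}
    (hT : ∀ i ∈ T, i + u.length ≤ m) (k : ℕ) :
    #{x ∈ Ico (0 : ℤ) m | k ≤ env u T m x} ≤ #{x ∈ Ico (0 : ℤ) m | k ≤ env v T m x} := by
  have hT' : ∀ i ∈ T, i + v.length ≤ m := by rwa [← h.length_eq]
  rcases Nat.lt_or_ge k 2 with hk | hk
  · refine card_le_card fun x hx => ?_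
    simp only [mem_filter, mem_Ico] at hx ⊢
    have := (env_pos_iff hT' x).2 hx.1
    exact ⟨hx.1, by omega⟩
  · obtain ⟨t, ht⟩ := h k (by omega)
    refine card_le_card_of_injOn (fun x => x + t) ?_ (fun _ _ _ _ => add_right_cancel)
    intro x hx
    simp only [mem_coe, mem_filter, mem_Ico, le_env_iff _ _ _ _ hk] at hx ⊢
    obtain ⟨-, i, hi, hx⟩ := hx
    rw [← ht] at hx
    have e : x - i + t = x + t - i := by ring
    rw [e] at hx
    have h1 := hT' i hi
    have h2 := (col_pos_iff v _).1 (by omega : 0 < v.col (x + t - i))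
    exact ⟨by omega, i, hi, hx⟩

lemma sum_env_eq {u v : PWord} (h : LevelTranslate u v) {T : Finset ℕ} {m : ℕ}
    (hT : ∀ i ∈ T, i + u.length ≤ m) :
    ∑ x ∈ Ico (0 : ℤ) m, env u T m x = ∑ x ∈ Ico (0 : ℤ) m, env v T m x := by
  obtain ⟨B, hB⟩ := exists_col_le u
  obtain ⟨C, hC⟩ := exists_col_le v
  have hu := env_le (B := B + C + 1) (fun x => (hB x).trans (by omega)) (by omega) T m
  have hv := env_le (B := B + C + 1) (fun x => (hC x).trans (by omega)) (by omega) T m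
  rw [sum_eq_sum_card_le _ _ _ fun x _ => hu x, sum_eq_sum_card_le _ _ _ fun x _ => hv x]
  refine sum_congr rfl fun k _ => le_antisymm (card_le_env_le h hT k)
    (card_le_env_le h.symm (by rwa [← h.length_eq]) k)

open Classical in
/-- The embedding set of `u` in `w`, counted from `0`. -/
noncomputable def emb (u w : PWord) : Finset ℕ :=
  {i ∈ range w.length | ∀ x : ℤ, u.col (x - i) ≤ w.col x}

lemma mem_emb {u : PWord} (hu : u ≠ []) {w : PWord} {i : ℕ} :
    i ∈ emb u w ↔ ∀ x : ℤ, u.col (x - i) ≤ w.col x := by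
  simp only [emb, mem_filter, mem_range, and_iff_right_iff_imp]
  intro h
  have h1 := h i
  have := (col_pos_iff u (i - i)).2 (by have := List.length_pos_iff.2 hu; omega)
  have := (col_pos_iff w i).1 (by omega)
  omega

lemma Em_eq_iff {u v : PWord} (hu : u ≠ []) (hv : v ≠ []) (w w' : PWord) :
    Em u w = Em v w' ↔ emb u w = emb v w' := by
  simp only [Set.ext_iff, Finset.ext_iff, mem_Em_iff hu, mem_Em_iff hv, mem_emb hu, mem_emb hv]
  constructor
  · intro h i
    have := h (i + 1)
    simpa using this
  · intro h j
    simp only [h]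

lemma subset_emb_iff {u : PWord} (hu : u ≠ []) (T : Finset ℕ) (w : PWord) :
    T ⊆ emb u w ↔ ∀ x, env u T w.length x ≤ w.col x := by
  rw [env_le_col_iff]
  simp only [subset_iff, mem_emb hu]

lemma add_length_le_of_mem_emb {u : PWord} (hu : u ≠ []) {w : PWord} {i : ℕ}
    (hi : i ∈ emb u w) : i + u.length ≤ w.length := by
  have hlen := List.length_pos_iff.2 hu
  have h1 := (mem_emb hu).1 hi (i + u.length - 1)
  have h2 := (col_pos_iff u (i + u.length - 1 - i)).2 (by omega)
  have h3 := (col_pos_iff w (i + u.length - 1)).1 (by omega)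
  omega

lemma card_subset_emb_eq {u v : PWord} (hu : u ≠ []) (h : LevelTranslate u v) (m N : ℕ)
    (T : Finset ℕ) :
    #{w ∈ wordsOf m N | T ⊆ emb u w} = #{w ∈ wordsOf m N | T ⊆ emb v w} := by
  classical
  have hv : v ≠ [] := by
    rw [← List.length_pos_iff, ← h.length_eq]; exact List.length_pos_iff.2 hu
  by_cases hT : ∀ i ∈ T, i + u.length ≤ m
  · have hT' : ∀ i ∈ T, i + v.length ≤ m := by rwa [← h.length_eq]
    have e : ∀ u' : PWord, u' ≠ [] → {w ∈ wordsOf m N | T ⊆ emb u' w} =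
        {w ∈ wordsOf m N | ∀ x, env u' T m x ≤ w.col x} := by
      intro u' hu'
      refine filter_congr fun w hw => ?_
      rw [subset_emb_iff hu', (mem_wordsOf.1 hw).1]
    rw [e u hu, e v hv]
    have hs := sum_env_eq h hT
    exact le_antisymm (card_dominating_le (env_pos_iff hT') hs)
      (card_dominating_le (env_pos_iff hT) hs.symm)
  · push Not at hT
    obtain ⟨i, hi, hlt⟩ := hT
    rw [filter_false_of_mem, filter_false_of_mem]
    · intro w hw hsub
      have := add_length_le_of_mem_emb hv (hsub hi)
      rw [(mem_wordsOf.1 hw).1, ← h.length_eq] at this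
      omega
    · intro w hw hsub
      have := add_length_le_of_mem_emb hu (hsub hi)
      rw [(mem_wordsOf.1 hw).1] at this
      omega

lemma LevelTranslate.superStrongWilfEquiv {u v : PWord} (hu : u ≠ []) (h : LevelTranslate u v) :
    SuperStrongWilfEquiv u v := by
  classical
  have hv : v ≠ [] := by
    rw [← List.length_pos_iff, ← h.length_eq]; exact List.length_pos_iff.2 hu
  have hcard : ∀ (m N : ℕ) (T : Finset ℕ),
      #{w ∈ wordsOf m N | emb u w = T} = #{w ∈ wordsOf m N | emb v w = T} := by
    intro m N T
    have e : ∀ (u' : PWord), ∀ w ∈ wordsOf m N, emb u' w ⊆ range m := by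
      intro u' w hw
      rw [← (mem_wordsOf.1 hw).1]
      exact filter_subset _ _
    exact card_eq_of_card_superset_eq _ _ _ (range m) (e u) (e v) (card_subset_emb_eq hu h m N) T
  -- The fibres of `key u` and `key v` are finite of equal size; bijections between them glue to the
  -- required one.
  let key : PWord → PWord → ℕ × ℕ × Finset ℕ := fun u' w => (w.length, w.norm, emb u' w)
  have hfib : ∀ c, Nonempty ({w // key u w = c} ≃ {w // key v w = c}) := by
    rintro ⟨m, N, T⟩
    have e : ∀ u' : PWord, ∀ w,
        key u' w = (m, N, T) ↔ w ∈ ({w ∈ wordsOf m N | emb u' w = T} : Finset PWord) := by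
      intro u' w
      simp only [key, Prod.mk.injEq, mem_filter, mem_wordsOf, and_assoc]
    exact ⟨(Equiv.subtypeEquivRight (e u)).trans ((Finset.equivOfCardEq (hcard m N T)).trans
      (Equiv.subtypeEquivRight (e v)).symm)⟩
  let f := Equiv.ofFiberEquiv (f := key u) (g := key v) fun c => (hfib c).some
  have hf : ∀ w, key v (f w) = key u w := Equiv.ofFiberEquiv_map _
  refine ⟨f, fun w => ?_, fun w => ?_⟩
  · have := hf w
    simp only [key, Prod.mk.injEq] at this
    exact ⟨this.1, this.2.1⟩
  · have := hf w
    simp only [key, Prod.mk.injEq] at this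
    exact (Em_eq_iff hu hv w (f w)).2 this.2.2.symm

end PWord

namespace PWord

/-! ### Permutations -/

lemma exists_col_of_mem {w : PWord} {a : ℕ+} (ha : a ∈ w) : ∃ x, w.col x = a := by
  obtain ⟨i, hi, rfl⟩ := List.getElem_of_mem ha
  exact ⟨i, col_of_lt w i hi⟩

lemma exists_mem_of_col {w : PWord} {x : ℤ} (hx : 0 < w.col x) : ∃ a ∈ w, w.col x = (a : ℕ) := by
  obtain ⟨h0, h1⟩ := (col_pos_iff w x).1 hx
  lift x to ℕ using h0
  exact ⟨_, List.getElem_mem (by omega), col_of_lt w x (by omega)⟩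

lemma col_le_of_mem_permWords {n : ℕ} {u : PWord} (hu : u ∈ permWords n) (x : ℤ) :
    u.col x ≤ n := by
  rcases Nat.eq_zero_or_pos (u.col x) with h | h
  · omega
  · obtain ⟨a, ha, h'⟩ := exists_mem_of_col h
    rw [h']
    exact (hu.2 a).1 ha

lemma exists_col_eq_of_mem_permWords {n : ℕ} {u : PWord} (hu : u ∈ permWords n) {h : ℕ}
    (h1 : 1 ≤ h) (hn : h ≤ n) : ∃ x, u.col x = h :=
  exists_col_of_mem ((hu.2 ⟨h, h1⟩).2 hn)

lemma col_inj_of_mem_permWords {n : ℕ} {u : PWord} (hu : u ∈ permWords n) {x y : ℤ}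
    (hx : 0 < u.col x) (hxy : u.col x = u.col y) : x = y := by
  have hy := hxy ▸ hx
  obtain ⟨h0, h1⟩ := (col_pos_iff u x).1 hx
  obtain ⟨h0', h1'⟩ := (col_pos_iff u y).1 hy
  lift x to ℕ using h0
  lift y to ℕ using h0'
  rw [col_of_lt u x (by omega), col_of_lt u y (by omega)] at hxy
  have := (List.Nodup.getElem_inj_iff hu.1).1 (PNat.coe_injective hxy)
  exact_mod_cast this

lemma length_of_mem_permWords {n : ℕ} {u : PWord} (hu : u ∈ permWords n) : u.length = n := by
  have h : #(Ico (0 : ℤ) u.length) = #(Icc 1 n) := by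
    refine card_bij (fun x _ => u.col x) ?_ ?_ ?_
    · intro x hx
      have := (col_pos_iff u x).2 (by simpa using hx)
      have := col_le_of_mem_permWords hu x
      exact mem_Icc.2 ⟨by omega, this⟩
    · intro x hx y _ h
      exact col_inj_of_mem_permWords hu ((col_pos_iff u x).2 (by simpa using hx)) h
    · intro k hk
      rw [mem_Icc] at hk
      obtain ⟨x, hx⟩ := exists_col_eq_of_mem_permWords hu hk.1 hk.2
      exact ⟨x, by simpa using (col_pos_iff u x).1 (by omega), hx⟩
  simpa using h

lemma ne_nil_of_mem_permWords {n : ℕ} (hn : 1 ≤ n) {u : PWord} (hu : u ∈ permWords n) :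
    u ≠ [] := by
  have := length_of_mem_permWords hu
  rintro rfl
  simp at this
  omega

lemma reverse_mem_permWords {n : ℕ} {u : PWord} (hu : u ∈ permWords n) :
    u.reverse ∈ permWords n :=
  ⟨List.nodup_reverse.2 hu.1, fun a => by rw [List.mem_reverse]; exact hu.2 a⟩

/-- The columns of `u` of height at least `h`. -/
noncomputable def level (u : PWord) (h : ℕ) : Finset ℤ := {x ∈ Ico (0 : ℤ) u.length | h ≤ u.col x}

lemma mem_level {u : PWord} {h : ℕ} (hh : 1 ≤ h) {x : ℤ} : x ∈ u.level h ↔ h ≤ u.col x := by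
  simp only [level, mem_filter, mem_Ico, and_iff_right_iff_imp]
  exact fun hx => (col_pos_iff u x).1 (by omega)

lemma card_level {n : ℕ} {u : PWord} (hu : u ∈ permWords n) {h : ℕ} (hh : 1 ≤ h) :
    #(u.level h) = n + 1 - h := by
  rw [← Nat.card_Icc h n]
  refine card_bij (fun x _ => u.col x) ?_ ?_ ?_
  · intro x hx
    rw [mem_level hh] at hx
    exact mem_Icc.2 ⟨hx, col_le_of_mem_permWords hu x⟩
  · intro x hx y _ h
    rw [mem_level hh] at hx
    exact col_inj_of_mem_permWords hu (by omega) h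
  · intro k hk
    rw [mem_Icc] at hk
    obtain ⟨x, hx⟩ := exists_col_eq_of_mem_permWords hu (hh.trans hk.1) hk.2
    exact ⟨x, (mem_level hh).2 (by omega), hx⟩

/-! ### Super-strong Wilf equivalence determines the level sets up to translation -/

/-- The image under `f` of the least word for `u` embeds `v` at all of `T`, so it dominates the
least word for `v`. -/
lemma sum_env_le_of_superStrongWilfEquiv {u v : PWord} (hu : u ≠ []) (hv : v ≠ [])
    (h : SuperStrongWilfEquiv u v) {T : Finset ℕ} {m : ℕ} (hT : ∀ i ∈ T, i + u.length ≤ m) :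
    ∑ x ∈ Ico (0 : ℤ) m, env v T m x ≤ ∑ x ∈ Ico (0 : ℤ) m, env u T m x := by
  obtain ⟨f, h1, h2⟩ := h
  obtain ⟨w, hw, hwc⟩ := exists_env_word hT
  have hsub : T ⊆ emb u w := (subset_emb_iff hu T w).2 fun x => by rw [hw, hwc]
  rw [(Em_eq_iff hu hv w (f w)).1 (h2 w), subset_emb_iff hv, (h1 w).1, hw] at hsub
  calc ∑ x ∈ Ico (0 : ℤ) m, env v T m x ≤ ∑ x ∈ Ico (0 : ℤ) m, (f w).col x :=
        sum_le_sum fun x _ => hsub x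
    _ = ∑ x ∈ Ico (0 : ℤ) m, w.col x := by
        have := (h1 w).2
        rwa [norm_eq_sum_col, norm_eq_sum_col, (h1 w).1, hw] at this
    _ = ∑ x ∈ Ico (0 : ℤ) m, env u T m x := sum_congr rfl fun x _ => hwc x

lemma sum_env_eq_of_superStrongWilfEquiv {u v : PWord} (hu : u ≠ []) (hv : v ≠ [])
    (hl : u.length = v.length)
    (h : SuperStrongWilfEquiv u v) {T : Finset ℕ} {m : ℕ} (hT : ∀ i ∈ T, i + u.length ≤ m) :
    ∑ x ∈ Ico (0 : ℤ) m, env u T m x = ∑ x ∈ Ico (0 : ℤ) m, env v T m x :=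
  le_antisymm (sum_env_le_of_superStrongWilfEquiv hv hu h.symm (by rwa [← hl]))
    (sum_env_le_of_superStrongWilfEquiv hu hv h hT)

/-- The places in `[0, 3 n)` outside the reflected set `2 n - X`. -/
noncomputable def avoid (n : ℕ) (X : Finset ℤ) : Finset ℕ := {i ∈ range (3 * n) | (2 * n - i : ℤ) ∉ X}

/-- The number of columns of height `h` lost by omitting the places in `2 n - X` equals the
number of ways of placing the `h`-th level set inside `X`. -/
lemma card_env_lost_iff {n : ℕ} {w : PWord} (hw : w.length = n) {X : Finset ℤ}
    (hX : X ⊆ Ico 0 (n : ℤ)) {h : ℕ} (hh : 2 ≤ h) (hne : (w.level h).Nonempty) (x : ℤ) :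
    (h ≤ env w (range (3 * n)) (4 * n) x ∧ ¬ h ≤ env w (avoid n X) (4 * n) x) ↔
      ∀ a ∈ w.level h, a - x + 2 * n ∈ X := by
  have hb : ∀ a ∈ w.level h, 0 ≤ a ∧ a < n := by
    intro a ha
    rw [mem_level (by omega)] at ha
    have := (col_pos_iff w a).1 (by omega)
    omega
  have hX' : ∀ a ∈ X, 0 ≤ a ∧ a < n := fun a ha => by simpa using hX ha
  have mem : ∀ T : Finset ℕ, h ≤ env w T (4 * n) x ↔ ∃ a ∈ w.level h, ∃ i ∈ T, x - i = a := by
    intro T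
    rw [le_env_iff _ _ _ _ hh]
    constructor
    · rintro ⟨i, hi, h1⟩
      exact ⟨x - i, (mem_level (by omega)).2 h1, i, hi, rfl⟩
    · rintro ⟨a, ha, i, hi, rfl⟩
      exact ⟨i, hi, (mem_level (by omega)).1 ha⟩
  rw [mem, mem]
  constructor
  · rintro ⟨⟨a, ha, i, hi, hxi⟩, hno⟩
    push Not at hno
    have aux : ∀ a ∈ w.level h, ∀ i ∈ range (3 * n), x - i = a → a - x + 2 * n ∈ X := by
      intro a ha i hi hxi
      by_contra hc
      refine hno a ha i (mem_filter.2 ⟨hi, ?_⟩) hxi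
      rwa [show (2 * n - i : ℤ) = a - x + 2 * n by omega]
    -- Both `a` and `a - x + 2 * n` lie in `[0, n)`, so `n < x < 3 * n` and every place `x - b`
    -- falls in `[0, 3 * n)`. Thus all of them, not just one, must be omitted.
    have h1 := hX' _ (aux a ha i hi hxi)
    have h2 := hb a ha
    intro b hb'
    have h3 := hb b hb'
    exact aux b hb' (x - b).toNat (mem_range.2 (by omega)) (by omega)
  · intro hall
    obtain ⟨a, ha⟩ := hne
    have h1 := hX' _ (hall a ha)
    have h2 := hb a ha
    refine ⟨⟨a, ha, (x - a).toNat, mem_range.2 (by omega), by omega⟩, ?_⟩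
    rintro ⟨b, hb', i, hi, hxi⟩
    refine (mem_filter.1 hi).2 ?_
    rw [show (2 * n - i : ℤ) = b - x + 2 * n by omega]
    exact hall b hb'

/-- The number of columns of height at least `h` in the least word dominating copies of `w` at
all places in `[0, 3 n)` that are lower when the places in `2 n - X` are omitted. -/
noncomputable def lost (n : ℕ) (X : Finset ℤ) (w : PWord) (h : ℕ) : ℕ :=
  #{x ∈ Ico (0 : ℤ) (4 * n : ℕ) |
    h ≤ env w (range (3 * n)) (4 * n) x ∧ ¬ h ≤ env w (avoid n X) (4 * n) x}

lemma sum_lost_eq {n : ℕ} {u v : PWord} (hn : 1 ≤ n) (hu : u ∈ permWords n)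
    (hv : v ∈ permWords n) (h : SuperStrongWilfEquiv u v) (X : Finset ℤ) :
    ∑ k ∈ Icc 1 n, lost n X u k = ∑ k ∈ Icc 1 n, lost n X v k := by
  have hu' := ne_nil_of_mem_permWords hn hu
  have hv' := ne_nil_of_mem_permWords hn hv
  have lu := length_of_mem_permWords hu
  have lv := length_of_mem_permWords hv
  have hR : ∀ i ∈ range (3 * n), i + u.length ≤ 4 * n := by
    intro i hi; rw [mem_range] at hi; omega
  have hS : ∀ i ∈ avoid n X, i + u.length ≤ 4 * n := fun i hi => hR i (mem_filter.1 hi).1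
  have key : ∀ w ∈ permWords n, ∑ k ∈ Icc 1 n, lost n X w k +
      ∑ x ∈ Ico (0 : ℤ) (4 * n : ℕ), env w (avoid n X) (4 * n) x =
      ∑ x ∈ Ico (0 : ℤ) (4 * n : ℕ), env w (range (3 * n)) (4 * n) x := by
    intro w hw
    have hle := env_le (col_le_of_mem_permWords hw) hn
    rw [sum_eq_sum_card_le _ _ _ fun x _ => hle (avoid n X) _ x,
      sum_eq_sum_card_le _ _ _ fun x _ => hle (range (3 * n)) _ x, ← sum_add_distrib]
    refine sum_congr rfl fun k _ => ?_
    have hmono : ∀ x, env w (avoid n X) (4 * n) x ≤ env w (range (3 * n)) (4 * n) x := fun x =>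
      max_le_max le_rfl (Finset.sup_mono (filter_subset _ _))
    rw [lost, ← card_union_of_disjoint, ← filter_or]
    · congr 1
      refine filter_congr fun x _ => ?_
      have := hmono x
      omega
    · exact disjoint_filter.2 fun x _ h1 h2 => h1.2 h2
  have e1 := key u hu
  have e2 := key v hv
  rw [sum_env_eq_of_superStrongWilfEquiv hu' hv' (lu.trans lv.symm) h hR,
    sum_env_eq_of_superStrongWilfEquiv hu' hv' (lu.trans lv.symm) h hS] at e1
  omega

lemma lost_one {n : ℕ} {u : PWord} (hu : u.length = n) (X : Finset ℤ) : lost n X u 1 = 0 := by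
  rw [lost, card_eq_zero, filter_eq_empty_iff]
  intro x hx
  rw [mem_Ico] at hx
  have := (env_pos_iff (u := u) (T := avoid n X) (m := 4 * n) (fun i hi => by
    have := mem_range.1 (mem_filter.1 hi).1; omega) x).2 hx
  omega

/-- The count is of translates of a level fitting inside `X`, and so depends only on the level's
translation class. -/
lemma lost_le_of_translate {n : ℕ} {u v : PWord} (hu : u ∈ permWords n) (hv : v ∈ permWords n)
    {X : Finset ℤ} (hX : X ⊆ Ico 0 (n : ℤ)) {k : ℕ} (hk : 2 ≤ k) (hkn : k ≤ n)
    (h : ∃ t : ℤ, ∀ x : ℤ, k ≤ v.col (x + t) ↔ k ≤ u.col x) :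
    lost n X u k ≤ lost n X v k := by
  obtain ⟨t, ht⟩ := h
  have hne : ∀ w ∈ permWords n, (w.level k).Nonempty := fun w hw => by
    rw [← card_pos, card_level hw (by omega)]; omega
  have lu := length_of_mem_permWords hu
  have lv := length_of_mem_permWords hv
  refine card_le_card_of_injOn (fun x => x + t) ?_ (fun _ _ _ _ => add_right_cancel)
  intro x hx
  simp only [mem_coe, mem_filter] at hx ⊢
  rw [card_env_lost_iff lu hX hk (hne u hu)] at hx
  have h1 : ∀ a ∈ v.level k, a - (x + t) + 2 * n ∈ X := by
    intro a ha
    rw [mem_level (by omega)] at ha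
    have := (ht (a - t)).1 (by rwa [sub_add_cancel])
    have := hx.2 _ ((mem_level (by omega)).2 this)
    rwa [show a - (x + t) + 2 * n = a - t - x + 2 * n by ring]
  refine ⟨?_, (card_env_lost_iff lv hX hk (hne v hv) _).2 h1⟩
  obtain ⟨a, ha⟩ := hne v hv
  have h2 := mem_Ico.1 (hX (h1 a ha))
  rw [mem_level (by omega)] at ha
  have := (col_pos_iff v a).1 (by omega)
  rw [mem_Ico]
  push_cast
  omega

/-- Probe with `X` equal to the `k`-th level of `u`. The total loss is the same for `u` and `v`; all
other levels contribute equally, so the `k`-th level of `v` also fits into `X`. -/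
lemma levelTranslate_of_superStrongWilfEquiv {n : ℕ} {u v : PWord} (hn : 1 ≤ n)
    (hu : u ∈ permWords n) (hv : v ∈ permWords n) (h : SuperStrongWilfEquiv u v) :
    LevelTranslate u v := by
  have lu := length_of_mem_permWords hu
  have lv := length_of_mem_permWords hv
  -- Induction on `d` runs down from the top level, so all levels above `k` are already matched.
  have main : ∀ d k : ℕ, n ≤ k + d → 1 ≤ k →
      ∃ t : ℤ, ∀ x : ℤ, k ≤ v.col (x + t) ↔ k ≤ u.col x := by
    intro d
    induction d using Nat.strong_induction_on with
    | h d ih =>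
    intro k hd hk
    rcases Nat.lt_or_ge n k with hkn | hkn
    · refine ⟨0, fun x => ?_⟩
      have := col_le_of_mem_permWords hu x
      have := col_le_of_mem_permWords hv (x + 0)
      omega
    rcases Nat.lt_or_ge k 2 with hk2 | hk2
    · refine ⟨0, fun x => ?_⟩
      have h1 := col_pos_iff u x
      have h2 := col_pos_iff v x
      rw [add_zero]
      rw [lv, ← lu, ← h1] at h2
      omega
    have hne : ∀ w ∈ permWords n, ∀ j ∈ Icc 1 n, (w.level j).Nonempty := fun w hw j hj => by
      rw [mem_Icc] at hj
      rw [← card_pos, card_level hw (by omega)]; omega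
    have hX : u.level k ⊆ Ico 0 (n : ℤ) := by
      rw [← lu]; exact filter_subset _ _
    -- Levels below `k` have too many columns to fit inside `X`.
    have hzero : ∀ w ∈ permWords n, ∀ j, 2 ≤ j → j < k → lost n (u.level k) w j = 0 := by
      intro w hw j hj hjk
      rw [lost, card_eq_zero, filter_eq_empty_iff]
      intro x _
      rw [card_env_lost_iff (length_of_mem_permWords hw) hX hj
        (hne w hw j (mem_Icc.2 (by omega)))]
      intro hall
      have := card_le_card_of_injOn (fun a => a - x + 2 * n) hall
        (fun a _ b _ hab => by simpa using hab)
      rw [card_level hw (by omega), card_level hu (by omega)] at this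
      omega
    have hrest : ∀ j ∈ (Icc 1 n).erase k, lost n (u.level k) u j = lost n (u.level k) v j := by
      intro j hj
      rw [mem_erase, mem_Icc] at hj
      rcases Nat.lt_or_ge j 2 with hj2 | hj2
      · obtain rfl : j = 1 := by omega
        rw [lost_one lu, lost_one lv]
      rcases Nat.lt_or_ge j k with hjk | hjk
      · rw [hzero u hu j hj2 hjk, hzero v hv j hj2 hjk]
      · obtain ⟨t, ht⟩ := ih (n - j) (by omega) j (by omega) (by omega)
        refine le_antisymm (lost_le_of_translate hu hv hX hj2 hj.2.2 ⟨t, ht⟩)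
          (lost_le_of_translate hv hu hX hj2 hj.2.2
            ⟨-t, fun x => by rw [← ht, neg_add_cancel_right]⟩)
    have hkm : k ∈ Icc 1 n := mem_Icc.2 ⟨hk, hkn⟩
    have hs := sum_lost_eq hn hu hv h (u.level k)
    rw [← add_sum_erase _ _ hkm, ← add_sum_erase (Icc 1 n) (lost n (u.level k) v) hkm,
      sum_congr rfl hrest, Nat.add_right_cancel_iff] at hs
    -- The column `2 * n` corresponds to the zero translation of the level into itself.
    have hpos : 0 < lost n (u.level k) u k := by
      refine card_pos.2 ⟨2 * n, mem_filter.2 ⟨mem_Ico.2 (by push_cast; omega), ?_⟩⟩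
      rw [card_env_lost_iff lu hX hk2 (hne u hu k hkm)]
      intro a ha
      rwa [sub_add_cancel]
    rw [hs] at hpos
    obtain ⟨x, hx⟩ := card_pos.1 hpos
    have hx2 := (card_env_lost_iff lv hX hk2 (hne v hv k hkm) x).1 (mem_filter.1 hx).2
    have hinj : Set.InjOn (fun a : ℤ => a - x + 2 * n) (v.level k) :=
      fun a _ b _ hab => by simpa using hab
    have himg : (v.level k).image (fun a => a - x + 2 * n) = u.level k := by
      refine eq_of_subset_of_card_le (image_subset_iff.2 hx2) ?_
      rw [card_image_of_injOn hinj, card_level hu hk, card_level hv hk]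
    refine ⟨x - 2 * n, fun y => ?_⟩
    rw [← mem_level hk, ← mem_level hk, ← himg, mem_image]
    constructor
    · exact fun hy => ⟨_, hy, by ring⟩
    · rintro ⟨a, ha, rfl⟩
      rwa [show a - x + 2 * n + (x - 2 * n) = a by ring]
  exact fun k hk => main n k (by omega) hk

/-! ### Words with translated level sets are connected by rigid shifts -/

/-- Cut at `c` and move by the translation of level `c + 1`. The move is legal because level `c + 1`
of `v` lies inside its level `c`, which `w` shares. -/
lemma exists_rigidShift_step {w v : PWord} (h : LevelTranslate w v) {c : ℕ} (hc : 1 ≤ c)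
    (heq : ∀ j, j ≤ c → ∀ x, j ≤ w.col x ↔ j ≤ v.col x) :
    ∃ w', RigidShift w w' ∧ ∀ j, j ≤ c + 1 → ∀ x, j ≤ w'.col x ↔ j ≤ v.col x := by
  obtain ⟨k, hk⟩ := h (c + 1) (by omega)
  have hsub : ∀ x, c < w.col x → c ≤ w.col (x + k) := by
    intro x hx
    rw [heq c le_rfl]
    have := (hk x).2 hx
    omega
  obtain ⟨w', hl, hw'⟩ := exists_col_eq (fun x => min (w.col x) c + (w.col (x - k) - c)) w.length
    (fun x => by
      have h1 := hsub (x - k)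
      rw [sub_add_cancel] at h1
      rw [← col_pos_iff]
      omega)
  refine ⟨w', ⟨hl, c, k, fun i hi => by have := hsub i hi; omega, hw'⟩, fun j hj x => ?_⟩
  have h1 := hsub (x - k)
  have h2 := hk (x - k)
  rw [sub_add_cancel] at h1 h2
  have h3 := heq j
  have h4 := heq c le_rfl x
  rw [hw']
  rcases Nat.lt_or_ge c j with hjc | hjc
  · obtain rfl : j = c + 1 := by omega
    omega
  · have := h3 hjc x
    omega

lemma LevelTranslate.exists_chain {u v : PWord} (h : LevelTranslate u v) (c : ℕ) :
    ∃ w, Relation.ReflTransGen RigidShift u w ∧ LevelTranslate w v ∧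
      ∀ j, j ≤ c + 1 → ∀ x, j ≤ w.col x ↔ j ≤ v.col x := by
  induction c with
  | zero =>
    refine ⟨u, .refl, h, fun j hj x => ?_⟩
    have h1 := col_pos_iff u x
    have h2 := col_pos_iff v x
    rw [← h.length_eq, ← h1] at h2
    omega
  | succ c ih =>
    obtain ⟨w, h1, h2, h3⟩ := ih
    obtain ⟨w', h4, h5⟩ := exists_rigidShift_step h2 (by omega) h3
    exact ⟨w', h1.tail h4, (LevelTranslate.of_rigidShift h4).symm.trans h2, h5⟩

lemma LevelTranslate.reflTransGen_rigidShift {u v : PWord} (h : LevelTranslate u v) :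
    Relation.ReflTransGen RigidShift u v := by
  obtain ⟨B, hB⟩ := exists_col_le v
  -- Agreement reaches level `B + 1`, which is empty for `v`; so `w` cannot rise higher either.
  obtain ⟨w, h1, -, h2⟩ := h.exists_chain B
  obtain rfl : w = v := by
    refine col_injective fun x => ?_
    have a := hB x
    by_contra hne
    rcases Nat.lt_or_gt_of_ne hne with hlt | hlt
    · have := h2 (v.col x) (by omega) x
      omega
    · have := h2 (v.col x + 1) (by omega) x
      omega
  exact h1

lemma shiftEquiv_iff (u v : PWord) :
    ShiftEquiv u v ↔ LevelTranslate u v ∨ LevelTranslate u.reverse v := by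
  constructor
  · intro h
    induction h with
    | refl => exact Or.inl (.refl u)
    | tail _ hbc ih =>
      rcases hbc with hbc | rfl
      · have := LevelTranslate.of_rigidShift hbc
        exact ih.imp (fun h => h.trans this) (fun h => h.trans this)
      · rcases ih with ih | ih
        · exact Or.inr ih.reverse
        · have := ih.reverse
          rw [List.reverse_reverse] at this
          exact Or.inl this
  · rintro (h | h)
    · exact Relation.ReflTransGen.mono (fun _ _ h => Or.inl h) _ _ h.reflTransGen_rigidShift
    · exact .head (Or.inr rfl) (Relation.ReflTransGen.mono (fun _ _ h => Or.inl h)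
        _ _ h.reflTransGen_rigidShift)

end PWord

namespace PWord

/-! ### Words whose level sets are symmetric -/

/-- If `x` were interior, both endpoints would survive its removal, making `x` the centre. An
interior `y` would then have to be the centre too; if `y` is an endpoint, the gap at `x` is off the
new centre. With three points this fails, which is where `swapWord` comes from. -/
lemma eq_endpoint_of_symmetric {a b x y : ℤ} (hab : a + 4 ≤ b) (hx : a ≤ x ∧ x < b)
    (hy : a ≤ y ∧ y < b) (hxy : y ≠ x)
    (h1 : ∃ c, ∀ z, (a ≤ c - z ∧ c - z < b ∧ c - z ≠ x) ↔ (a ≤ z ∧ z < b ∧ z ≠ x))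
    (h2 : ∃ c, ∀ z, (a ≤ c - z ∧ c - z < b ∧ c - z ≠ x ∧ c - z ≠ y) ↔
      (a ≤ z ∧ z < b ∧ z ≠ x ∧ z ≠ y)) :
    x = a ∨ x = b - 1 := by
  by_contra hne
  push Not at hne
  obtain ⟨c, hc⟩ := h1
  obtain ⟨d, hd⟩ := h2
  have hca := hc a
  have hcb := hc (b - 1)
  obtain rfl : c = a + b - 1 := by omega
  have hcx := hc x
  have hmid : 2 * x = a + b - 1 := by omega
  have hda := hd a
  have hdb := hd (b - 1)
  have hda' := hd (a + 1)
  have hdb' := hd (b - 2)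
  have hdx := hd x
  have hdy := hd y
  by_cases hya : y = a
  · omega
  by_cases hyb : y = b - 1
  · omega
  have : d = a + b - 1 := by omega
  omega

lemma exists_reflection {u : PWord} (h : LevelTranslate u u.reverse) {k : ℕ} (hk : 1 ≤ k) :
    ∃ c : ℤ, ∀ x, k ≤ u.col (c - x) ↔ k ≤ u.col x := by
  obtain ⟨t, ht⟩ := h k hk
  refine ⟨u.length - 1 - t, fun x => ?_⟩
  rw [← ht, col_reverse]
  ring_nf

/-- The columns of `u` of height at least `h` are consecutive, and `n + 1 - h` in number. -/
def LevelInterval (n : ℕ) (u : PWord) (h : ℕ) : Prop :=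
  ∃ a : ℤ, ∀ x, h ≤ u.col x ↔ a ≤ x ∧ x < a + (n + 1 - h)

lemma succ_le_col_iff {n : ℕ} {u : PWord} (hu : u ∈ permWords n) {h : ℕ} {p : ℤ}
    (hh : 1 ≤ h) (hp : u.col p = h) (x : ℤ) : h + 1 ≤ u.col x ↔ h ≤ u.col x ∧ x ≠ p := by
  constructor
  · intro hx
    refine ⟨by omega, ?_⟩
    rintro rfl
    omega
  · rintro ⟨h1, h2⟩
    rcases h1.lt_or_eq with h1 | h1
    · exact h1
    · exact absurd (col_inj_of_mem_permWords hu (by omega) (h1.symm.trans hp.symm)) h2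

lemma levelInterval_one {n : ℕ} {u : PWord} (hu : u ∈ permWords n) : LevelInterval n u 1 := by
  refine ⟨0, fun x => ?_⟩
  have := col_pos_iff u x
  rw [length_of_mem_permWords hu] at this
  push_cast
  omega

lemma levelInterval_top {n : ℕ} (hn : 1 ≤ n) {u : PWord} (hu : u ∈ permWords n) :
    LevelInterval n u n := by
  obtain ⟨p, hp⟩ := exists_col_eq_of_mem_permWords hu hn le_rfl
  refine ⟨p, fun x => ?_⟩
  constructor
  · intro hx
    have h1 := col_le_of_mem_permWords hu x
    have := col_inj_of_mem_permWords hu (x := x) (y := p) (by omega) (by omega)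
    omega
  · intro hx
    obtain rfl : x = p := by omega
    omega

/-- Each level loses one column to the next; while at least four columns remain, symmetry of the
next two levels forces the loss to be at an end. -/
lemma levelInterval_of_symmetric {n : ℕ} {u : PWord} (hu : u ∈ permWords n)
    (h : LevelTranslate u u.reverse) (k : ℕ) (hk : k + 3 ≤ n) : LevelInterval n u (k + 1) := by
  induction k with
  | zero => exact levelInterval_one hu
  | succ k ih =>
    obtain ⟨a, ha⟩ := ih (by omega)
    obtain ⟨p, hp⟩ := exists_col_eq_of_mem_permWords hu (h := k + 1) (by omega) (by omega)
    obtain ⟨q, hq⟩ := exists_col_eq_of_mem_permWords hu (h := k + 2) (by omega) (by omega)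
    have hA := succ_le_col_iff hu (by omega) hp
    have hB := succ_le_col_iff hu (by omega) hq
    have hend := eq_endpoint_of_symmetric (a := a) (b := a + (n + 1 - (k + 1 : ℕ))) (x := p)
      (y := q) (by push_cast; omega) ((ha p).1 (by omega)) ((ha q).1 (by omega))
      (by rintro rfl; omega) ?_ ?_
    · rcases hend with rfl | hp'
      · refine ⟨p + 1, fun x => ?_⟩
        rw [hA, ha]
        push_cast
        omega
      · refine ⟨a, fun x => ?_⟩
        rw [hA, ha]
        push_cast at hp' ⊢
        omega
    · obtain ⟨c, hc⟩ := exists_reflection h (k := k + 2) (by omega)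
      refine ⟨c, fun z => ?_⟩
      have := hc z
      rw [hA, hA, ha, ha] at this
      simpa only [and_assoc] using this
    · obtain ⟨c, hc⟩ := exists_reflection h (k := k + 3) (by omega)
      refine ⟨c, fun z => ?_⟩
      have := hc z
      rw [hB, hB, hA, hA, ha, ha] at this
      simpa only [and_assoc] using this

/-! ### The two exceptional words. -/

lemma col_idWord (n : ℕ) (x : ℤ) (hx : 0 ≤ x ∧ x < n) : ((idWord n).col x : ℤ) = x + 1 := by
  obtain ⟨h0, h1⟩ := hx
  lift x to ℕ using h0
  rw [col_of_lt _ _ (by simp [idWord]; omega)]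
  simp [idWord]

lemma length_idWord (n : ℕ) : (idWord n).length = n := by simp [idWord]

lemma le_col_idWord_iff (n : ℕ) {h : ℕ} (hh : 1 ≤ h) (x : ℤ) :
    h ≤ (idWord n).col x ↔ (h : ℤ) ≤ x + 1 ∧ x < n := by
  by_cases hx : 0 ≤ x ∧ x < n
  · have := col_idWord n x hx
    omega
  · rw [col_eq_zero _ _ (by rwa [length_idWord])]
    omega

lemma length_swapWord {n : ℕ} (hn : 3 ≤ n) : (swapWord n).length = n := by
  simp [swapWord]; omega

lemma col_swapWord {n : ℕ} (hn : 3 ≤ n) (x : ℕ) (hx : x < n) :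
    (swapWord n).col x = if x = n - 3 then n - 1 else if x = n - 2 then n - 2 else x + 1 := by
  rw [col_of_lt _ _ (by rw [length_swapWord hn]; exact hx)]
  rcases Nat.lt_or_ge x (n - 3) with h | h
  · rw [if_neg (by omega), if_neg (by omega)]
    simp [swapWord, h]
  · obtain ⟨m, rfl⟩ := Nat.exists_eq_add_of_le' hn
    obtain ⟨i, rfl⟩ := Nat.exists_eq_add_of_le h
    have hi : i < 3 := by omega
    interval_cases i <;> simp [swapWord]

lemma le_col_swapWord_iff {n : ℕ} (hn : 3 ≤ n) {h : ℕ} (hh : 1 ≤ h) (x : ℤ) :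
    h ≤ (swapWord n).col x ↔
      if h = n - 1 then x = n - 3 ∨ x = n - 1 else (h : ℤ) ≤ x + 1 ∧ x < n := by
  by_cases hx : 0 ≤ x ∧ x < n
  · obtain ⟨h0, h1⟩ := hx
    lift x to ℕ using h0
    rw [col_swapWord hn x (by omega)]
    split_ifs <;> omega
  · rw [col_eq_zero _ _ (by rwa [length_swapWord hn])]
    split_ifs <;> omega

lemma mem_permWords_of_col {n : ℕ} {w : PWord} (hl : w.length = n)
    (h : ∀ k, 1 ≤ k → k ≤ n → ∃ x, w.col x = k) : w ∈ permWords n := by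
  have hsub : ∀ a : ℕ+, (a : ℕ) ≤ n → a ∈ w := by
    intro a ha
    obtain ⟨x, hx⟩ := h a a.pos ha
    obtain ⟨b, hb, hxb⟩ := exists_mem_of_col (w := w) (x := x) (by rw [hx]; exact a.pos)
    rwa [PNat.coe_injective (hx.symm.trans hxb)]
  have hset : (range n).image Nat.succPNat ⊆ w.toFinset := by
    intro a ha
    obtain ⟨i, hi, rfl⟩ := mem_image.1 ha
    exact List.mem_toFinset.2 (hsub _ (by simpa using hi))
  have hcard : #((range n).image Nat.succPNat) = n := by
    rw [card_image_of_injective _ Nat.succPNat_injective, card_range]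
  have hle := List.toFinset_card_le w
  have heq := eq_of_subset_of_card_le hset (by omega)
  have hnd : w.Nodup := Multiset.coe_nodup.1 (Multiset.toFinset_card_eq_card_iff_nodup.1
    (show #w.toFinset = w.length by have := card_le_card hset; omega))
  refine ⟨hnd, fun a => ⟨fun ha => ?_, hsub a⟩⟩
  rw [← List.mem_toFinset, ← heq, mem_image] at ha
  obtain ⟨i, hi, rfl⟩ := ha
  simpa using hi

lemma idWord_mem_permWords (n : ℕ) : idWord n ∈ permWords n := by
  refine mem_permWords_of_col (length_idWord n) fun k h1 h2 => ⟨k - 1, ?_⟩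
  have := col_idWord n (k - 1) (by omega)
  omega

lemma swapWord_mem_permWords {n : ℕ} (hn : 3 ≤ n) : swapWord n ∈ permWords n := by
  refine mem_permWords_of_col (length_swapWord hn) fun k h1 h2 => ?_
  by_cases e1 : k = n - 1
  · exact ⟨(n - 3 : ℕ), by rw [col_swapWord hn _ (by omega), if_pos rfl, e1]⟩
  by_cases e2 : k = n - 2
  · exact ⟨(n - 2 : ℕ), by rw [col_swapWord hn _ (by omega), if_neg (by omega), if_pos rfl, e2]⟩
  exact ⟨(k - 1 : ℕ), by
    rw [col_swapWord hn _ (by omega), if_neg (by omega), if_neg (by omega)]; omega⟩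

lemma levelTranslate_idWord_reverse (n : ℕ) : LevelTranslate (idWord n) (idWord n).reverse := by
  intro h hh
  refine ⟨1 - h, fun x => ?_⟩
  rw [col_reverse, le_col_idWord_iff n hh, le_col_idWord_iff n hh, length_idWord]
  omega

lemma levelTranslate_swapWord_reverse {n : ℕ} (hn : 3 ≤ n) :
    LevelTranslate (swapWord n) (swapWord n).reverse := by
  intro h hh
  by_cases e : h = n - 1
  -- This level is `{n - 3, n - 1}`, and `{0, 2}` after reversal.
  · refine ⟨3 - n, fun x => ?_⟩
    rw [col_reverse, le_col_swapWord_iff hn hh, le_col_swapWord_iff hn hh, length_swapWord hn,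
      if_pos e, if_pos e]
    omega
  · refine ⟨1 - h, fun x => ?_⟩
    rw [col_reverse, le_col_swapWord_iff hn hh, le_col_swapWord_iff hn hh, length_swapWord hn,
      if_neg e, if_neg e]
    omega

lemma levelTranslate_idWord_or_swapWord {n : ℕ} {u : PWord} (hn : 1 ≤ n)
    (hu : u ∈ permWords n) (h : LevelTranslate u u.reverse) :
    LevelTranslate u (idWord n) ∨ 3 ≤ n ∧ LevelTranslate u (swapWord n) := by
  have hlow : ∀ k, 1 ≤ k → k ≤ n → k ≠ n - 1 → LevelInterval n u k := by
    intro k hk hkn hk1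
    rcases hkn.eq_or_lt with rfl | hlt
    · exact levelInterval_top hn hu
    · obtain ⟨k, rfl⟩ := Nat.exists_eq_add_of_le' hk
      exact levelInterval_of_symmetric hu h k (by omega)
  have hbig : ∀ k, n < k → ∀ x, ¬ k ≤ u.col x := fun k hk x => by
    have := col_le_of_mem_permWords hu x
    omega
  -- Level `n - 1` is the only one in doubt; the guard excludes level 0, which is all of `ℤ`.
  by_cases hI : 2 ≤ n → LevelInterval n u (n - 1)
  · left
    intro k hk
    by_cases hkn : k ≤ n
    · obtain ⟨a, ha⟩ : LevelInterval n u k := by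
        by_cases e : k = n - 1
        · exact e ▸ hI (by omega)
        · exact hlow k hk hkn e
      refine ⟨k - 1 - a, fun x => ?_⟩
      rw [le_col_idWord_iff n hk, ha]
      omega
    · refine ⟨0, fun x => ?_⟩
      rw [le_col_idWord_iff n hk, iff_false_right (hbig k (by omega) x)]
      omega
  · right
    push Not at hI
    obtain ⟨hn2, hI⟩ := hI
    have hn3 : 3 ≤ n := by
      by_contra hlt
      obtain rfl : n = 2 := by omega
      exact hI (levelInterval_one hu)
    refine ⟨hn3, ?_⟩
    obtain ⟨a, ha⟩ := hlow (n - 2) (by omega) (by omega) (by omega)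
    obtain ⟨p, hp⟩ := exists_col_eq_of_mem_permWords hu (h := n - 2) (by omega) (by omega)
    have hA := succ_le_col_iff hu (by omega) hp
    rw [show n - 2 + 1 = n - 1 by omega] at hA
    have hpa := (ha p).1 (by omega)
    -- Level `n - 2` has three columns; losing an end one would leave an interval.
    have hp1 : p = a + 1 := by
      by_contra hne
      rcases Int.lt_or_gt_of_ne hne with hlt | hgt
      · exact hI ⟨a + 1, fun x => by rw [hA, ha]; omega⟩
      · exact hI ⟨a, fun x => by rw [hA, ha]; omega⟩
    intro k hk
    by_cases hkn : k ≤ n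
    · by_cases e : k = n - 1
      · refine ⟨n - 3 - a, fun x => ?_⟩
        rw [le_col_swapWord_iff hn3 hk, if_pos e, e, hA, ha]
        omega
      · obtain ⟨a, ha⟩ := hlow k hk hkn e
        refine ⟨k - 1 - a, fun x => ?_⟩
        rw [le_col_swapWord_iff hn3 hk, if_neg e, ha]
        omega
    · refine ⟨0, fun x => ?_⟩
      rw [le_col_swapWord_iff hn3 hk, iff_false_right (hbig k (by omega) x), if_neg (by omega)]
      omega

/-! ### Classes of permutations in terms of level sets. -/

lemma superStrongWilfEquiv_iff {n : ℕ} {u v : PWord} (hn : 1 ≤ n) (hu : u ∈ permWords n)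
    (hv : v ∈ permWords n) : SuperStrongWilfEquiv u v ↔ LevelTranslate u v :=
  ⟨levelTranslate_of_superStrongWilfEquiv hn hu hv,
    LevelTranslate.superStrongWilfEquiv (ne_nil_of_mem_permWords hn hu)⟩

lemma levelTranslate_reverse_iff {n : ℕ} {u : PWord} (hn : 1 ≤ n) (hu : u ∈ permWords n) :
    LevelTranslate u u.reverse ↔
      SuperStrongWilfEquiv u (idWord n) ∨ (3 ≤ n ∧ SuperStrongWilfEquiv u (swapWord n)) := by
  have transfer : ∀ w : PWord, LevelTranslate w w.reverse → LevelTranslate u w →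
      LevelTranslate u u.reverse := fun w hw h => (h.trans hw).trans h.symm.reverse
  rw [superStrongWilfEquiv_iff hn hu (idWord_mem_permWords n)]
  constructor
  · exact fun h => (levelTranslate_idWord_or_swapWord hn hu h).imp_right fun h =>
      ⟨h.1, (superStrongWilfEquiv_iff hn hu (swapWord_mem_permWords h.1)).2 h.2⟩
  · rintro (h | ⟨h3, h⟩)
    · exact transfer _ (levelTranslate_idWord_reverse n) h
    · rw [superStrongWilfEquiv_iff hn hu (swapWord_mem_permWords h3)] at h
      exact transfer _ (levelTranslate_swapWord_reverse h3) h

lemma mem_ssClass_iff {n : ℕ} {u : PWord} (hn : 1 ≤ n) (hu : u ∈ permWords n) (w : PWord) :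
    w ∈ ssClass n u ↔ w ∈ permWords n ∧ LevelTranslate u w :=
  and_congr_right fun hw => superStrongWilfEquiv_iff hn hu hw

lemma shClass_eq {n : ℕ} {u : PWord} (hn : 1 ≤ n) (hu : u ∈ permWords n) :
    shClass n u = ssClass n u ∪ ssClass n u.reverse := by
  ext w
  rw [Set.mem_union, mem_ssClass_iff hn hu, mem_ssClass_iff hn (reverse_mem_permWords hu),
    ← and_or_left, ← shiftEquiv_iff]
  rfl

end PWord

open PWord
theorem theorem5p5 (n : ℕ) (hn : 1 ≤ n) (u : PWord) (hu : u ∈ permWords n) :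
    ((SuperStrongWilfEquiv u (idWord n) ∨ (3 ≤ n ∧ SuperStrongWilfEquiv u (swapWord n))) →
      shClass n u = ssClass n u) ∧
    (¬ (SuperStrongWilfEquiv u (idWord n) ∨ (3 ≤ n ∧ SuperStrongWilfEquiv u (swapWord n))) →
      shClass n u = ssClass n u ∪ ssClass n u.reverse ∧
      Disjoint (ssClass n u) (ssClass n u.reverse)) := by
  rw [← levelTranslate_reverse_iff hn hu]
  have hu' := reverse_mem_permWords hu
  refine ⟨fun h => ?_, fun h => ⟨shClass_eq hn hu, ?_⟩⟩
  · rw [shClass_eq hn hu, Set.union_eq_left]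
    intro w
    rw [mem_ssClass_iff hn hu, mem_ssClass_iff hn hu']
    exact fun hw => ⟨hw.1, h.trans hw.2⟩
  · rw [Set.disjoint_left]
    intro w
    rw [mem_ssClass_iff hn hu, mem_ssClass_iff hn hu']
    exact fun h1 h2 => h (h1.2.trans h2.2.symm)
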